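/- Let $\lambda_m,\lambda_s,P_M,G_M,P_S,G_{S,0},P_V,G_{V,0},G_{V,1},\alpha_M,\alpha_S$ be positive reals. Macro base stations (MBSs) form a homogeneous Poisson point process (PPP) of density $\lambda_m$ in $\mathbb R^2$; the small base stations (SBSs) on the typical road, a line through the origin identified with $\mathbb R$, form a homogeneous 1D PPP of density $\lambda_s$. Each MBS carries a shadowing gain $\chi_M$ and each SBS a shadowing gain $\chi_S$, with $10\log_{10}\chi_i\sim\mathcal N(\omega_i,\delta_i^2)$; all gains and the two point processes are mutually independent. Each MBS at $x$ is displaced to $\chi_M^{-1/\alpha_M}x$ and each SBS at $x$ to $\chi_S^{-1/\alpha_S}x$; let $X_M$ and $X_S$ be the distances from the origin (the typical vehicle) to the nearest displaced MBS and the nearest displaced SBS. Put $$\lambda_M=\mathbb E\big[\chi_M^{2/\alpha_M}\big]\lambda_m,\quad \lambda_S=\mathbb E\big[\chi_S^{1/\alpha_S}\big]\lambda_s,\quad A=\frac{P_MG_M}{P_SG_{S,0}},\quad B=\frac{P_VG_{V,1}}{P_VG_{V,0}},$$ and assume $A>B$. Case 1 is the event that the vehicle associates with an MBS both in the downlink and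 in the uplink, i.e. that $$P_MG_MX_M^{-\alpha_M}>P_SG_{S,0}X_S^{-\alpha_S}\quad\text{and}\quad P_VG_{V,1}X_M^{-\alpha_M}>P_VG_{V,0}X_S^{-\alpha_S}.$$ Then $$\Pr(\text{Case 1})=1-\int_0^\infty 2\lambda_S\exp\Big(-\lambda_M\pi B^{2/\alpha_M}x^{2\alpha_S/\alpha_M}-2\lambda_Sx\Big)\,dx,$$ the integral being convergent, and if $\alpha_S=\alpha_M=\alpha$, then $$\Pr(\text{Case 1})=1-\sqrt{\frac{\lambda_S^2}{\lambda_MB^{2/\alpha}}}\,\exp\Big(\frac{\lambda_S^2}{\lambda_M\pi B^{2/\alpha}}\Big)\,\mathrm{erfc}\Big(\frac{\lambda_S}{\sqrt{\lambda_M\pi B^{2/\alpha}}}\Big),$$ where $\mathrm{erfc}(z)=\frac{2}{\sqrt\pi}\int_z^\infty e^{-t^2}\,dt$. -/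

import Mathlib

open MeasureTheory ProbabilityTheory
open scoped NNReal ENNReal

noncomputable section

namespace CV2X

/-- The complementary error function `erfc x = (2 / √π) ∫_x^∞ exp (-t²) dt`. -/
def erfc (x : ℝ) : ℝ :=
  2 / Real.sqrt Real.pi * ∫ t in Set.Ioi x, Real.exp (-t ^ 2)

section PointProcesses

variable {Ω E : Type*}

/-- The number of points of the random sequence `X 0, X 1, …` that lie in `B`, with
multiplicity. -/
def pointCount (X : ℕ → Ω → E) (B : Set E) (ω : Ω) : ℕ∞ :=
  {i : ℕ | X i ω ∈ B}.encard

/-- The points `X 0, X 1, …` form a homogeneous Poisson point process on `E` with density `lam`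
with respect to the volume: the number of points in a set of finite volume is Poisson with mean
`lam * volume B`, and the numbers of points in disjoint sets are independent.  (For `lam > 0` and
`E` of infinite volume there are almost surely infinitely many points, so that an enumeration by
`ℕ` is no restriction.) -/
structure IsPoissonProcess [MeasurableSpace Ω] [MeasureSpace E]
    (P : Measure Ω) (lam : ℝ) (X : ℕ → Ω → E) : Prop where
  measurable : ∀ i, Measurable (X i)
  poisson : ∀ B : Set E, MeasurableSet B → volume B ≠ ∞ → ∀ k : ℕ,
    P {ω | pointCount X B ω = k}
      = poissonMeasure (ENNReal.ofReal lam * volume B).toNNReal {k}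
  indep : ∀ (n : ℕ) (B : Fin n → Set E), (∀ j, MeasurableSet (B j)) →
    Pairwise (fun j k => Disjoint (B j) (B k)) →
    iIndepFun (fun j => pointCount X (B j)) P

/-- The law of a log-normal shadowing gain `χ` with `10 log₁₀ χ ∼ N(w, δ²)`. -/
def shadowingLaw (w : ℝ) (δ : ℝ≥0) : Measure ℝ :=
  (gaussianReal w (δ ^ 2)).map (fun z => (10 : ℝ) ^ (z / 10))

/-- A Poisson point process of density `lam` whose points carry independent shadowing gains
`χ 0, χ 1, …`, identically distributed with `10 log₁₀ χ ∼ N(w, δ²)` and independent of the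
points. -/
structure IsShadowedPoissonProcess [MeasurableSpace Ω] [MeasureSpace E]
    (P : Measure Ω) (lam w : ℝ) (δ : ℝ≥0) (X : ℕ → Ω → E) (χ : ℕ → Ω → ℝ) : Prop where
  points : IsPoissonProcess P lam X
  gain_measurable : ∀ i, Measurable (χ i)
  gain_law : ∀ i, P.map (χ i) = shadowingLaw w δ
  gain_indep : iIndepFun χ P
  gain_indep_points : IndepFun (fun ω i => χ i ω) (fun ω i => X i ω) P

/-- Random displacement: the point `x` with shadowing gain `χ` is moved to `y = χ^(-1/α) x`, so
that `χ ‖x‖^(-α) = ‖y‖^(-α)`. -/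
def displaced [SMul ℝ E] (α : ℝ) (X : ℕ → Ω → E) (χ : ℕ → Ω → ℝ) (i : ℕ) (ω : Ω) : E :=
  (χ i ω) ^ (-(1 / α)) • X i ω

/-- The distance from the origin to the nearest of the points `Y 0, Y 1, …`. -/
def nearestDist [Norm E] (Y : ℕ → Ω → E) (ω : Ω) : ℝ :=
  ⨅ i, ‖Y i ω‖

end PointProcesses

/-- The density of a `d`-dimensional Poisson process of density `lam` after the random displacement
`y = χ^(-1/α) x`, namely `E[χ^(d/α)] * lam`. -/
def displacedDensity (d : ℕ) (lam α w : ℝ) (δ : ℝ≥0) : ℝ :=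
  (∫ c, c ^ ((d : ℝ) / α) ∂(shadowingLaw w δ)) * lam

/-- The moments of the shadowing gain are finite. -/
theorem integrable_rpow_shadowingLaw (w : ℝ) (δ : ℝ≥0) (s : ℝ) :
    Integrable (fun c : ℝ => c ^ s) (shadowingLaw w δ) := by
  have hm : Measurable (fun z : ℝ => (10 : ℝ) ^ (z / 10)) := by fun_prop
  have hs : Measurable (fun c : ℝ => c ^ s) := by fun_prop
  rw [shadowingLaw, integrable_map_measure hs.aestronglyMeasurable hm.aemeasurable]
  have : ((fun c : ℝ => c ^ s) ∘ fun z : ℝ => (10 : ℝ) ^ (z / 10))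
      = fun z => Real.exp (Real.log 10 * s / 10 * z) := by
    funext z
    simp only [Function.comp]
    rw [← Real.rpow_mul (by norm_num), Real.rpow_def_of_pos (by norm_num)]
    congr 1
    ring
  rw [this]
  exact integrable_exp_mul_gaussianReal _

/-- If the shadowing has mean `0` dB then `E[χ^s] = E[χ^(-s)]`. -/
theorem integral_rpow_shadowingLaw_zero (δ : ℝ≥0) (s : ℝ) :
    ∫ c, c ^ s ∂(shadowingLaw 0 δ) = ∫ c, c ^ (-s) ∂(shadowingLaw 0 δ) := by
  have hm : Measurable (fun z : ℝ => (10 : ℝ) ^ (z / 10)) := by fun_prop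
  have hs : ∀ t : ℝ, Measurable (fun c : ℝ => c ^ t) := fun t => by fun_prop
  rw [shadowingLaw, integral_map hm.aemeasurable (hs s).aestronglyMeasurable,
    integral_map hm.aemeasurable (hs (-s)).aestronglyMeasurable]
  have hneg : gaussianReal 0 (δ ^ 2) = (gaussianReal 0 (δ ^ 2)).map (fun x => -x) := by
    rw [gaussianReal_map_neg, neg_zero]
  conv_lhs => rw [hneg]
  rw [integral_map (f := fun z : ℝ => ((10 : ℝ) ^ (z / 10)) ^ s) (by fun_prop)
    ((hs s).comp hm).aestronglyMeasurable]
  refine integral_congr_ae (Filter.Eventually.of_forall fun z => ?_)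
  simp only
  rw [← Real.rpow_mul (by norm_num), ← Real.rpow_mul (by norm_num)]
  congr 1
  ring

/-- Downlink association rule: a vehicle whose nearest MBS and nearest SBS (after displacement) are
at distances `xM` and `xS` associates with the MBS in the downlink. -/
def DownlinkMBS (PM GM PS GS0 αM αS xM xS : ℝ) : Prop :=
  PM * GM * xM ^ (-αM) > PS * GS0 * xS ^ (-αS)

/-- Uplink association rule: a vehicle whose nearest MBS and nearest SBS (after displacement) are
at distances `xM` and `xS` associates with the MBS in the uplink. -/
def UplinkMBS (PV GV1 GV0 αM αS xM xS : ℝ) : Prop :=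
  PV * GV1 * xM ^ (-αM) > PV * GV0 * xS ^ (-αS)

/-- The event Case 1: the typical vehicle, at the origin, associates with the MBS tier both in the
downlink and in the uplink.  `X`, `χ` are the locations and shadowing gains of the MBSs in the
plane; `S`, `ψ` those of the SBSs on the typical road, a line through the origin whose points are
given by their signed distance to the origin. -/
def caseOne {Ω : Type*} (PM GM PS GS0 PV GV1 GV0 αM αS : ℝ)
    (X : ℕ → Ω → EuclideanSpace ℝ (Fin 2)) (χ : ℕ → Ω → ℝ)
    (S : ℕ → Ω → ℝ) (ψ : ℕ → Ω → ℝ) : Set Ω :=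
  {ω | DownlinkMBS PM GM PS GS0 αM αS
          (nearestDist (displaced αM X χ) ω) (nearestDist (displaced αS S ψ) ω) ∧
        UplinkMBS PV GV1 GV0 αM αS
          (nearestDist (displaced αM X χ) ω) (nearestDist (displaced αS S ψ) ω)}

end CV2X

end

/-! Since `B < A`, the uplink rule implies the downlink rule, so up to a null set Case 1 is the
event `X_M < B ^ (1/αM) * X_S ^ (αS/αM)`. The two distances are independent, with tails `exp (-λ_M π
r²)` and `exp (-2 λ_S r)`. Averaging the tail of `X_M` over the exponential law of `X_S` gives the
probability of the complement; for equal exponents, completing the square produces `erfc`.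

The tails are void probabilities of the displaced processes. It is not necessary to know that these
are Poisson. Given the locations, the points stay outside the ball of radius `r` independently, a
point at `x` failing to do so with probability `u x`. The void probability is therefore `E ∏ (1 - u
(X i)) = exp (-λ ∫ u)`, the probability generating functional (`lintegral_iInf_prod`), and Tonelli
evaluates `∫ u` as a ball volume times a moment of the gain. The functional comes from independent
Poisson counts for simple `u`, then from monotone approximation. Infinite products with factors at
most 1 are infima of finite products, so no question of convergence arises. -/

/-! ### Poisson counts and their generating function -/

theorem CV2X.measurable_pointCount {Ω E : Type*} [MeasurableSpace Ω] [MeasurableSpace E]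
    {X : ℕ → Ω → E} (hX : ∀ i, Measurable (X i)) {B : Set E} (hB : MeasurableSet B) :
    Measurable (CV2X.pointCount X B) := by
  refine measurable_encard.comp (measurable_set_iff.2 fun i => ?_)
  exact measurableSet_setOfPred.1 (hX i hB)

/-- The power `c ^ n` for an extended natural exponent, as the infimum of the powers below. -/
noncomputable def ENNReal.infPow (c : ℝ≥0∞) (n : ℕ∞) : ℝ≥0∞ :=
  ⨅ (k : ℕ) (_ : (k : ℕ∞) ≤ n), c ^ k

theorem ENNReal.infPow_natCast {c : ℝ≥0∞} (hc : c ≤ 1) (n : ℕ) :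
    c.infPow n = c ^ n := by
  refine le_antisymm (iInf₂_le (f := fun (k : ℕ) (_ : (k : ℕ∞) ≤ n) => c ^ k) n le_rfl) (le_iInf₂ fun k hk => ?_)
  exact pow_le_pow_right_of_le_one' hc (by exact_mod_cast hk)

/-- Each partial product is a power of `c` counting the hits among the first `k` points. Every
finite set of hits lies in some initial segment, so both infima run over the same powers, even when
the count is infinite. -/
theorem CV2X.iInf_prod_ite_mem_eq_infPow {Ω E : Type*} (X : ℕ → Ω → E) (B : Set E)
    [DecidablePred (· ∈ B)] {c : ℝ≥0∞} (hc : c ≤ 1) (ω : Ω) :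
    ⨅ k : ℕ, ∏ i ∈ Finset.range k, (if X i ω ∈ B then c else 1)
      = c.infPow (CV2X.pointCount X B ω) := by
  have key : ∀ k : ℕ, ∏ i ∈ Finset.range k, (if X i ω ∈ B then c else 1)
      = c ^ ((Finset.range k).filter fun i => X i ω ∈ B).card := fun k => by
    rw [Finset.prod_ite, Finset.prod_const, Finset.prod_const_one, mul_one]
  simp_rw [key]
  apply le_antisymm
  · refine le_iInf₂ fun k hk => ?_
    obtain ⟨t, ht, htk⟩ := Set.exists_subset_encard_eq hk
    have hfin : t.Finite := Set.finite_of_encard_eq_coe htk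
    lift t to Finset ℕ using hfin
    obtain ⟨m, hm⟩ := t.exists_nat_subset_range
    refine iInf_le_of_le m (pow_le_pow_right_of_le_one' hc ?_)
    have h1 : t.card = k := by simpa using htk
    rw [← h1]
    refine Finset.card_le_card fun i hi => Finset.mem_filter.2 ⟨hm hi, ht hi⟩
  · refine le_iInf fun k => iInf₂_le (f := fun (j : ℕ) (_ : (j : ℕ∞) ≤ CV2X.pointCount X B ω) => c ^ j) _ ?_
    rw [← Set.encard_coe_eq_coe_finsetCard]
    exact Set.encard_le_encard fun i hi => by simpa using (Finset.mem_filter.1 hi).2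

/-- The Poisson property prescribes only the masses at finite values. These already sum to 1, so an
inequality between probability measures suffices, and it is trivial at `⊤`. -/
theorem CV2X.IsPoissonProcess.map_pointCount {Ω E : Type*} [MeasurableSpace Ω] [MeasureSpace E]
    {P : Measure Ω} [IsProbabilityMeasure P] {lam : ℝ} {X : ℕ → Ω → E}
    (hX : CV2X.IsPoissonProcess P lam X) {B : Set E} (hB : MeasurableSet B)
    (hvol : volume B ≠ ∞) :
    P.map (CV2X.pointCount X B) =
      (poissonMeasure (ENNReal.ofReal lam * volume B).toNNReal).map (fun n : ℕ => (n : ℕ∞)) := by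
  have hN := CV2X.measurable_pointCount hX.measurable hB
  have := Measure.isProbabilityMeasure_map (μ := P) hN.aemeasurable
  set ρ := poissonMeasure (ENNReal.ofReal lam * volume B).toNNReal with hρ
  have hcast : Measurable (fun n : ℕ => (n : ℕ∞)) := measurable_of_countable _
  have := Measure.isProbabilityMeasure_map (μ := ρ) hcast.aemeasurable
  have hnat : ∀ k : ℕ, P.map (CV2X.pointCount X B) {(k : ℕ∞)}
      = ρ.map (fun n : ℕ => (n : ℕ∞)) {(k : ℕ∞)} := fun k => by
    rw [Measure.map_apply hN (measurableSet_singleton _),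
      Measure.map_apply hcast (measurableSet_singleton _)]
    have h2 : (fun n : ℕ => (n : ℕ∞)) ⁻¹' {(k : ℕ∞)} = {k} := by ext; simp
    rw [h2]
    exact hX.poisson B hB hvol k
  symm
  refine Measure.eq_of_le_of_isProbabilityMeasure ?_
  rw [Measure.le_iff]
  intro s hs
  rw [← lintegral_indicator_one hs, ← lintegral_indicator_one hs, lintegral_countable',
    lintegral_countable']
  refine ENNReal.tsum_le_tsum fun a => ?_
  refine mul_le_mul_right ?_ _
  induction a using ENat.recTopCoe with
  | top =>
    rw [Measure.map_apply hcast (measurableSet_singleton _)]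
    have h2 : (fun n : ℕ => (n : ℕ∞)) ⁻¹' {⊤} = ∅ := by ext; simp
    simp [h2]
  | coe k => exact (hnat k).ge

theorem ProbabilityTheory.lintegral_pow_poissonMeasure (r : ℝ≥0) {a : ℝ≥0∞} (ha : a ≤ 1) :
    ∫⁻ n, (1 - a) ^ n ∂(poissonMeasure r) = ENNReal.ofReal (Real.exp (-(a * r).toReal)) := by
  lift a to ℝ≥0 using ne_top_of_le_ne_top ENNReal.one_ne_top ha
  have ha' : a ≤ 1 := by exact_mod_cast ha
  have h1 : ∀ n : ℕ, (1 - (a : ℝ≥0∞)) ^ n * poissonMeasure r {n}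
      = ENNReal.ofReal (Real.exp (-r) * ((1 - a) * r : ℝ) ^ n / n.factorial) := fun n => by
    have h2 : (1 - (a : ℝ≥0∞)) = ENNReal.ofReal (1 - (a : ℝ)) := by
      rw [ENNReal.ofReal_sub _ a.coe_nonneg]; simp
    have h3 : (0 : ℝ) ≤ 1 - a := sub_nonneg.2 (by exact_mod_cast ha')
    rw [poissonMeasure_singleton, h2, ← ENNReal.ofReal_pow h3, ← ENNReal.ofReal_mul (by positivity)]
    congr 1
    rw [mul_pow]
    ring
  have h3 : (0 : ℝ) ≤ 1 - a := sub_nonneg.2 (by exact_mod_cast ha')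
  have hs : HasSum (fun n : ℕ => Real.exp (-r) * ((1 - a) * r : ℝ) ^ n / n.factorial)
      (Real.exp (-r) * Real.exp ((1 - a) * r)) := by
    simp_rw [mul_div_assoc]
    refine HasSum.mul_left _ ?_
    rw [Real.exp_eq_exp_ℝ]
    exact NormedSpace.expSeries_div_hasSum_exp _
  rw [lintegral_countable']
  simp_rw [h1]
  rw [← ENNReal.ofReal_tsum_of_nonneg (fun n => by positivity) hs.summable, hs.tsum_eq,
    ← Real.exp_add]
  congr 2
  simp
  ring

/-- The probability generating function of a Poisson count. -/
theorem CV2X.IsPoissonProcess.lintegral_infPow_pointCount {Ω E : Type*} [MeasurableSpace Ω]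
    [MeasureSpace E] {P : Measure Ω} [IsProbabilityMeasure P] {lam : ℝ} {X : ℕ → Ω → E}
    (hX : CV2X.IsPoissonProcess P lam X) {B : Set E} (hB : MeasurableSet B)
    (hvol : volume B ≠ ∞) {a : ℝ≥0∞} (ha : a ≤ 1) :
    ∫⁻ ω, (1 - a).infPow (CV2X.pointCount X B ω) ∂P
      = ENNReal.ofReal (Real.exp (-(ENNReal.ofReal lam * (a * volume B)).toReal)) := by
  have hN := CV2X.measurable_pointCount hX.measurable hB
  have hφ : Measurable (1 - a).infPow := measurable_of_countable _
  have hcast : Measurable (fun n : ℕ => (n : ℕ∞)) := measurable_of_countable _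
  rw [← lintegral_map hφ hN, hX.map_pointCount hB hvol, lintegral_map hφ hcast]
  simp_rw [ENNReal.infPow_natCast (tsub_le_self : 1 - a ≤ 1)]
  rw [lintegral_pow_poissonMeasure _ ha,
    ENNReal.coe_toNNReal (ENNReal.mul_ne_top ENNReal.ofReal_ne_top hvol)]
  congr 4
  ring

/-! ### The probability generating functional -/

theorem ENNReal.iInf_finset_prod_of_antitone {ι : Type*} (s : Finset ι) {f : ι → ℕ → ℝ≥0∞}
    (hf : ∀ i ∈ s, Antitone (f i)) (hf1 : ∀ i ∈ s, ∀ n, f i n ≤ 1) :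
    ⨅ n, ∏ i ∈ s, f i n = ∏ i ∈ s, ⨅ n, f i n := by
  have h1 : Filter.Tendsto (fun n => ∏ i ∈ s, f i n) Filter.atTop
      (nhds (∏ i ∈ s, ⨅ n, f i n)) :=
    ENNReal.tendsto_finsetProd_of_ne_top s (fun i hi => tendsto_atTop_iInf (hf i hi))
      fun i hi => ne_top_of_le_ne_top ENNReal.one_ne_top (iInf_le_of_le 0 (hf1 i hi 0))
  refine tendsto_nhds_unique (tendsto_atTop_iInf fun m n hmn => ?_) h1
  exact Finset.prod_le_prod' fun i hi => hf i hi hmn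

theorem ENNReal.antitone_prod_range {f : ℕ → ℝ≥0∞} (hf : ∀ i, f i ≤ 1) :
    Antitone fun n => ∏ i ∈ Finset.range n, f i := fun _ _ hmn =>
  Finset.prod_le_prod_of_subset_of_le_one' (Finset.range_subset_range.2 hmn) fun i _ _ => hf i

/-- The probability generating functional of a Poisson process, for simple functions. -/
theorem CV2X.IsPoissonProcess.lintegral_iInf_prod_simpleFunc {Ω E : Type*} [MeasurableSpace Ω]
    [MeasureSpace E] {P : Measure Ω} [IsProbabilityMeasure P] {lam : ℝ} {X : ℕ → Ω → E}
    (hX : CV2X.IsPoissonProcess P lam X) (u : SimpleFunc E ℝ≥0∞) (hu : ∀ x, u x ≤ 1)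
    (hint : u.lintegral volume ≠ ∞) :
    ∫⁻ ω, ⨅ k : ℕ, ∏ i ∈ Finset.range k, (1 - u (X i ω)) ∂P
      = ENNReal.ofReal (Real.exp (-(ENNReal.ofReal lam * u.lintegral volume).toReal)) := by
  classical
  -- The value 0 is dropped: its level set may have infinite volume, and it contributes only factors
  -- 1.
  set F := u.range \ {0} with hF
  have hF1 : ∀ y ∈ F, y ≤ 1 := fun y hy => by
    obtain ⟨x, rfl⟩ := SimpleFunc.mem_range.1 (Finset.mem_sdiff.1 hy).1
    exact hu x
  have hvol : ∀ y ∈ F, volume (u ⁻¹' {y}) ≠ ∞ := fun y hy =>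
    (SimpleFunc.finMeasSupp_iff.1 (SimpleFunc.FinMeasSupp.of_lintegral_ne_top hint) y
      (by simpa using (Finset.mem_sdiff.1 hy).2)).ne
  have hfactor : ∀ x, 1 - u x = ∏ y ∈ F, if x ∈ u ⁻¹' {y} then 1 - y else 1 := fun x => by
    have : ∀ y, (x ∈ u ⁻¹' {y}) = (u x = y) := fun y => by simp
    simp_rw [this, Finset.prod_ite_eq]
    split_ifs with h
    · rfl
    · have : u x = 0 := by
        by_contra h0
        exact h (Finset.mem_sdiff.2 ⟨u.mem_range_self x, by simpa using h0⟩)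
      simp [this]
  have hle : ∀ (y : ℝ≥0∞) (x : E), (if x ∈ u ⁻¹' {y} then 1 - y else 1) ≤ (1 : ℝ≥0∞) :=
    fun y x => by split_ifs <;> simp
  have hpt : ∀ ω, ⨅ k : ℕ, ∏ i ∈ Finset.range k, (1 - u (X i ω))
      = ∏ y ∈ F, (1 - y).infPow (CV2X.pointCount X (u ⁻¹' {y}) ω) := fun ω => by
    simp_rw [hfactor]
    simp_rw [fun k : ℕ => Finset.prod_comm (s := Finset.range k) (t := F)
      (f := fun i y => if X i ω ∈ u ⁻¹' {y} then 1 - y else 1)]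
    rw [ENNReal.iInf_finset_prod_of_antitone]
    · exact Finset.prod_congr rfl fun y _ =>
        CV2X.iInf_prod_ite_mem_eq_infPow X _ tsub_le_self ω
    · exact fun y _ => ENNReal.antitone_prod_range fun i => hle y _
    · exact fun y _ n => Finset.prod_le_one' fun i _ => hle y _
  simp_rw [hpt]
  have hmeas : ∀ y : ℝ≥0∞, Measurable (1 - y).infPow := fun _ => measurable_of_countable _
  have hind : iIndepFun (fun (y : F) ω =>
      (1 - (y : ℝ≥0∞)).infPow (CV2X.pointCount X (u ⁻¹' {(y : ℝ≥0∞)}) ω)) P := by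
    -- Independence of counts is given for families indexed by `Fin n`, hence the enumeration of the
    -- level sets.
    let e := F.equivFin
    have h1 := hX.indep F.card (fun j => u ⁻¹' {((e.symm j : F) : ℝ≥0∞)})
      (fun j => u.measurableSet_preimage _) (fun j k hjk => by
        refine Disjoint.preimage _ (Set.disjoint_singleton.2 fun h => hjk ?_)
        exact e.symm.injective (Subtype.ext h))
    have h2 := h1.precomp e.injective
    simp only [Equiv.symm_apply_apply] at h2
    exact h2.comp (fun y => (1 - (y : ℝ≥0∞)).infPow) fun y => hmeas y
  have hprod : ∀ ω, ∏ y ∈ F, (1 - y).infPow (CV2X.pointCount X (u ⁻¹' {y}) ω)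
      = ∏ y : F, (1 - (y : ℝ≥0∞)).infPow (CV2X.pointCount X (u ⁻¹' {(y : ℝ≥0∞)}) ω) := fun ω =>
    (Finset.prod_coe_sort F fun y => (1 - y).infPow (CV2X.pointCount X (u ⁻¹' {y}) ω)).symm
  simp_rw [hprod]
  rw [lintegral_prod_eq_prod_lintegral_of_indepFun _ _ hind fun y => (hmeas y).comp
    (CV2X.measurable_pointCount hX.measurable (u.measurableSet_preimage _))]
  rw [Finset.prod_coe_sort F fun y =>
    ∫⁻ ω, (1 - y).infPow (CV2X.pointCount X (u ⁻¹' {y}) ω) ∂P]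
  rw [Finset.prod_congr rfl fun y hy => hX.lintegral_infPow_pointCount
    (u.measurableSet_preimage _) (hvol y hy) (hF1 y hy)]
  rw [← ENNReal.ofReal_prod_of_nonneg fun _ _ => (Real.exp_pos _).le, ← Real.exp_sum,
    Finset.sum_neg_distrib, ← ENNReal.toReal_sum, ← Finset.mul_sum,
    ← u.lintegral_eq_of_subset' (subset_refl F)]
  intro y hy
  exact ENNReal.mul_ne_top ENNReal.ofReal_ne_top (ENNReal.mul_ne_top
    (ne_top_of_le_ne_top ENNReal.one_ne_top (hF1 y hy)) (hvol y hy))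

/-- The probability generating functional of a Poisson process. -/
theorem CV2X.IsPoissonProcess.lintegral_iInf_prod {Ω E : Type*} [MeasurableSpace Ω]
    [MeasureSpace E] {P : Measure Ω} [IsProbabilityMeasure P] {lam : ℝ} {X : ℕ → Ω → E}
    (hX : CV2X.IsPoissonProcess P lam X) {u : E → ℝ≥0∞} (hum : Measurable u) (hu : ∀ x, u x ≤ 1)
    (hint : ∫⁻ x, u x ≠ ∞) :
    ∫⁻ ω, ⨅ k : ℕ, ∏ i ∈ Finset.range k, (1 - u (X i ω)) ∂P
      = ENNReal.ofReal (Real.exp (-(ENNReal.ofReal lam * ∫⁻ x, u x).toReal)) := by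
  set v := SimpleFunc.eapprox u with hv
  have hvu : ∀ n x, v n x ≤ u x := fun n x => by
    rw [← SimpleFunc.iSup_eapprox_apply hum x]
    exact le_iSup (fun n => v n x) n
  have hmono : Monotone v := SimpleFunc.monotone_eapprox u
  have hvint : ∀ n, (v n).lintegral volume ≤ ∫⁻ x, u x := fun n => by
    rw [← SimpleFunc.lintegral_eq_lintegral]
    exact lintegral_mono fun x => hvu n x
  have hpt : ∀ ω, ⨅ k : ℕ, ∏ i ∈ Finset.range k, (1 - u (X i ω))
      = ⨅ n : ℕ, ⨅ k : ℕ, ∏ i ∈ Finset.range k, (1 - v n (X i ω)) := fun ω => by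
    rw [iInf_comm]
    refine iInf_congr fun k => ?_
    rw [ENNReal.iInf_finset_prod_of_antitone]
    · refine Finset.prod_congr rfl fun i _ => ?_
      rw [← ENNReal.sub_iSup ENNReal.one_ne_top, SimpleFunc.iSup_eapprox_apply hum]
    · exact fun i _ m n hmn => tsub_le_tsub_left (hmono hmn _) _
    · exact fun i _ n => tsub_le_self
  simp_rw [hpt]
  rw [lintegral_iInf]
  · simp_rw [fun n => hX.lintegral_iInf_prod_simpleFunc (v n) (fun x => (hvu n x).trans (hu x))
      (ne_top_of_le_ne_top hint (hvint n))]
    refine tendsto_nhds_unique (tendsto_atTop_iInf fun m n hmn => ?_) ?_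
    · refine ENNReal.ofReal_le_ofReal (Real.exp_le_exp.2 (neg_le_neg ?_))
      refine ENNReal.toReal_mono (ENNReal.mul_ne_top ENNReal.ofReal_ne_top
        (ne_top_of_le_ne_top hint (hvint n))) ?_
      exact mul_le_mul_right (SimpleFunc.lintegral_mono (hmono hmn) le_rfl) _
    · refine ENNReal.tendsto_ofReal ((Real.continuous_exp.tendsto _).comp (Filter.Tendsto.neg ?_))
      refine (ENNReal.tendsto_toReal (ENNReal.mul_ne_top ENNReal.ofReal_ne_top hint)).comp ?_
      refine ENNReal.Tendsto.const_mul ?_ (Or.inr ENNReal.ofReal_ne_top)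
      rw [lintegral_eq_iSup_eapprox_lintegral hum]
      exact tendsto_atTop_iSup fun m n hmn => SimpleFunc.lintegral_mono (hmono hmn) le_rfl
  · intro n
    refine Measurable.iInf fun k => Finset.measurable_fun_prod _ fun i _ => ?_
    exact measurable_const.sub ((v n).measurable.comp (hX.measurable i))
  · intro m n hmn ω
    exact iInf_mono fun k => Finset.prod_le_prod' fun i _ => tsub_le_tsub_left (hmono hmn _) _
  -- Monotone convergence downwards needs a finite initial integral; the empty product bounds the
  -- integrand by 1.
  · refine ne_top_of_le_ne_top (b := ∫⁻ _, 1 ∂P) (by simp) (lintegral_mono fun ω => ?_)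
    exact iInf_le_of_le 0 (by simp)

/-! ### Void probabilities after random displacement -/

instance CV2X.isProbabilityMeasure_shadowingLaw (w : ℝ) (δ : ℝ≥0) :
    IsProbabilityMeasure (CV2X.shadowingLaw w δ) :=
  Measure.isProbabilityMeasure_map (by fun_prop)

theorem CV2X.ae_pos_shadowingLaw (w : ℝ) (δ : ℝ≥0) : ∀ᵐ c ∂(CV2X.shadowingLaw w δ), 0 < c := by
  rw [CV2X.shadowingLaw, ae_map_iff (by fun_prop) measurableSet_Ioi]
  exact Filter.Eventually.of_forall fun z => Real.rpow_pos_of_pos (by norm_num) _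

section Displacement

variable {Ω E : Type*} [MeasurableSpace Ω] [NormedAddCommGroup E] [MeasureSpace E] [BorelSpace E]

/-- By Tonelli the gain `c` may be fixed first; the condition then cuts out a ball of radius `r * c
^ (1/α)`, of volume `K * r ^ d * c ^ (d/α)`. Keeping `K` and `d` general covers both the plane and
the road. -/
theorem CV2X.lintegral_shadowingLaw_lt [SFinite (volume : Measure E)] {w α : ℝ} {δ : ℝ≥0}
    {d : ℕ} {K : ℝ} (hK : 0 ≤ K)
    (hball : ∀ s : ℝ, 0 ≤ s → volume (Metric.ball (0 : E) s) = ENNReal.ofReal (K * s ^ d))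
    {r : ℝ} (hr : 0 ≤ r) :
    ∫⁻ x : E, CV2X.shadowingLaw w δ {c | ‖c ^ (-(1 / α))‖ * ‖x‖ < r}
      = ENNReal.ofReal (K * r ^ d * ∫ c, c ^ ((d : ℝ) / α) ∂(CV2X.shadowingLaw w δ)) := by
  have hT : MeasurableSet {p : E × ℝ | ‖p.2 ^ (-(1 / α))‖ * ‖p.1‖ < r} :=
    measurableSet_lt (by fun_prop) measurable_const
  have h1 := Measure.prod_apply (μ := (volume : Measure E)) (ν := CV2X.shadowingLaw w δ) hT
  have h2 := Measure.prod_apply_symm (μ := (volume : Measure E)) (ν := CV2X.shadowingLaw w δ) hT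
  simp only [Set.preimage_ofPred_eq] at h1 h2
  rw [← h1, h2, ← integral_const_mul, ofReal_integral_eq_lintegral_ofReal
    ((CV2X.integrable_rpow_shadowingLaw w δ _).const_mul _)]
  · refine lintegral_congr_ae ?_
    filter_upwards [CV2X.ae_pos_shadowingLaw w δ] with c hc
    have hset : {x : E | ‖c ^ (-(1 / α))‖ * ‖x‖ < r} = Metric.ball 0 (r * c ^ (1 / α)) := by
      ext x
      have hp := Real.rpow_pos_of_pos hc (1 / α)
      rw [Set.mem_ofPred_eq, mem_ball_zero_iff, Real.rpow_neg hc.le, norm_inv,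
        Real.norm_of_nonneg hp.le, inv_mul_lt_iff₀ hp, mul_comm r]
    rw [hset, hball _ (mul_nonneg hr (Real.rpow_nonneg hc.le _)), mul_pow, ← mul_assoc,
      ← Real.rpow_natCast (c ^ (1 / α)), ← Real.rpow_mul hc.le]
    congr 3
    ring
  · filter_upwards [CV2X.ae_pos_shadowingLaw w δ] with c hc
    exact mul_nonneg (mul_nonneg hK (pow_nonneg hr _)) (Real.rpow_nonneg hc.le _)

variable [NormedSpace ℝ E]

theorem CV2X.measurable_nearestDist_displaced (α : ℝ) {X : ℕ → Ω → E} {χ : ℕ → Ω → ℝ}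
    (hX : ∀ i, Measurable (X i)) (hχ : ∀ i, Measurable (χ i)) :
    Measurable (CV2X.nearestDist (CV2X.displaced α X χ)) := by
  unfold CV2X.nearestDist CV2X.displaced
  simp_rw [norm_smul]
  refine Measurable.iInf fun i => ?_
  have := hX i
  have := hχ i
  fun_prop

/-- A fixed number of points is displaced away from the ball of radius `r` with the probability
obtained by averaging over the gains first. -/
theorem CV2X.IsShadowedPoissonProcess.measure_forall_lt_displaced
    {P : Measure Ω} [IsProbabilityMeasure P] {lam w α : ℝ} {δ : ℝ≥0} {X : ℕ → Ω → E}
    {χ : ℕ → Ω → ℝ} (hX : CV2X.IsShadowedPoissonProcess P lam w δ X χ) (r : ℝ) (k : ℕ) :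
    P {ω | ∀ i < k, r ≤ ‖CV2X.displaced α X χ i ω‖}
      = ∫⁻ ω, ∏ i ∈ Finset.range k,
          CV2X.shadowingLaw w δ {c | r ≤ ‖c ^ (-(1 / α))‖ * ‖X i ω‖} ∂P := by
  have hXm : Measurable fun ω i => X i ω := measurable_pi_lambda _ hX.points.measurable
  have hχm : Measurable fun ω i => χ i ω := measurable_pi_lambda _ hX.gain_measurable
  have hlaw := (indepFun_iff_map_prod_eq_prod_map_map hχm.aemeasurable hXm.aemeasurable).1
    hX.gain_indep_points
  have hD : ∀ i : ℕ, MeasurableSet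
      {p : (ℕ → ℝ) × (ℕ → E) | r ≤ ‖p.1 i ^ (-(1 / α))‖ * ‖p.2 i‖} := fun i =>
    measurableSet_le measurable_const (by fun_prop)
  have hT : MeasurableSet {p : (ℕ → ℝ) × (ℕ → E) |
      ∀ i < k, r ≤ ‖p.1 i ^ (-(1 / α))‖ * ‖p.2 i‖} := by
    have : {p : (ℕ → ℝ) × (ℕ → E) | ∀ i < k, r ≤ ‖p.1 i ^ (-(1 / α))‖ * ‖p.2 i‖}
        = ⋂ i, ⋂ (_ : i < k), {p | r ≤ ‖p.1 i ^ (-(1 / α))‖ * ‖p.2 i‖} := by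
      ext; simp
    rw [this]
    exact MeasurableSet.iInter fun i => MeasurableSet.iInter fun _ => hD i
  -- With the locations frozen at `x`, the conditions involve distinct gains and are independent.
  have hfac : ∀ x : ℕ → E,
      P.map (fun ω i => χ i ω) {c | ∀ i < k, r ≤ ‖c i ^ (-(1 / α))‖ * ‖x i‖}
      = ∏ i ∈ Finset.range k, CV2X.shadowingLaw w δ {c | r ≤ ‖c ^ (-(1 / α))‖ * ‖x i‖} := by
    intro x
    have hs : ∀ i, MeasurableSet {c : ℝ | r ≤ ‖c ^ (-(1 / α))‖ * ‖x i‖} := fun i =>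
      measurableSet_le measurable_const (by fun_prop)
    have hset : {c : ℕ → ℝ | ∀ i < k, r ≤ ‖c i ^ (-(1 / α))‖ * ‖x i‖}
        = ⋂ i ∈ Finset.range k, (fun c => c i) ⁻¹' {c : ℝ | r ≤ ‖c ^ (-(1 / α))‖ * ‖x i‖} := by
      ext; simp
    rw [hset, Measure.map_apply hχm (Finset.measurableSet_biInter _ fun i _ =>
      measurable_pi_apply i (hs i)), Set.preimage_iInter₂]
    refine (hX.gain_indep.meas_biInter (S := Finset.range k) (fun i _ => ⟨_, hs i, rfl⟩)).trans ?_
    refine Finset.prod_congr rfl fun i _ => ?_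
    rw [← hX.gain_law i, Measure.map_apply (hX.gain_measurable i) (hs i)]
  have h1 : P {ω | ∀ i < k, r ≤ ‖CV2X.displaced α X χ i ω‖}
      = P.map (fun ω => (fun i => χ i ω, fun i => X i ω))
        {p : (ℕ → ℝ) × (ℕ → E) | ∀ i < k, r ≤ ‖p.1 i ^ (-(1 / α))‖ * ‖p.2 i‖} := by
    rw [Measure.map_apply (hχm.prodMk hXm) hT]
    simp only [CV2X.displaced, norm_smul, Set.preimage_ofPred_eq]
  have := Measure.isProbabilityMeasure_map (μ := P) hXm.aemeasurable
  have := Measure.isProbabilityMeasure_map (μ := P) hχm.aemeasurable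
  rw [h1, hlaw, Measure.prod_apply_symm hT]
  simp only [Set.preimage_ofPred_eq, hfac]
  rw [lintegral_map _ hXm]
  have := measurable_measure_prodMk_right (μ := P.map (fun ω i => χ i ω)) hT
  simpa only [Set.preimage_ofPred_eq, hfac] using this

/-- The void probabilities of a displaced Poisson process on centred balls. -/
theorem CV2X.IsShadowedPoissonProcess.measure_le_nearestDist [SFinite (volume : Measure E)]
    {P : Measure Ω} [IsProbabilityMeasure P] {lam w α : ℝ} {δ : ℝ≥0} {X : ℕ → Ω → E}
    {χ : ℕ → Ω → ℝ} (hX : CV2X.IsShadowedPoissonProcess P lam w δ X χ) (hlam : 0 ≤ lam)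
    {d : ℕ} {K : ℝ} (hK : 0 ≤ K)
    (hball : ∀ s : ℝ, 0 ≤ s → volume (Metric.ball (0 : E) s) = ENNReal.ofReal (K * s ^ d))
    {r : ℝ} (hr : 0 ≤ r) :
    P {ω | r ≤ CV2X.nearestDist (CV2X.displaced α X χ) ω}
      = ENNReal.ofReal (Real.exp (-(CV2X.displacedDensity d lam α w δ * K * r ^ d))) := by
  -- The event is a decreasing limit of conditions on the first `k` points, so continuity from above
  -- applies.
  have hset : {ω | r ≤ CV2X.nearestDist (CV2X.displaced α X χ) ω}
      = ⋂ k : ℕ, {ω | ∀ i < k, r ≤ ‖CV2X.displaced α X χ i ω‖} := by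
    ext ω
    simp only [Set.mem_ofPred_eq, Set.mem_iInter, CV2X.nearestDist]
    rw [le_ciInf_iff ⟨0, by rintro _ ⟨i, rfl⟩; exact norm_nonneg _⟩]
    exact ⟨fun h _ i _ => h i, fun h i => h (i + 1) i i.lt_succ_self⟩
  have hXm := hX.points.measurable
  have hχm := hX.gain_measurable
  have hanti : Antitone fun k : ℕ => {ω | ∀ i < k, r ≤ ‖CV2X.displaced α X χ i ω‖} :=
    fun m n hmn ω hω i hi => hω i (hi.trans_le hmn)
  have hmeas : ∀ k : ℕ, MeasurableSet {ω | ∀ i < k, r ≤ ‖CV2X.displaced α X χ i ω‖} := by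
    intro k
    have : {ω | ∀ i < k, r ≤ ‖CV2X.displaced α X χ i ω‖}
        = ⋂ i, ⋂ (_ : i < k), {ω | r ≤ ‖CV2X.displaced α X χ i ω‖} := by
      ext; simp
    rw [this]
    refine MeasurableSet.iInter fun i => MeasurableSet.iInter fun _ => ?_
    simp only [CV2X.displaced, norm_smul]
    have := hXm i
    have := hχm i
    exact measurableSet_le measurable_const (by fun_prop)
  set u : E → ℝ≥0∞ := fun x => CV2X.shadowingLaw w δ {c | ‖c ^ (-(1 / α))‖ * ‖x‖ < r} with hu
  have hum : Measurable u := by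
    have hT : MeasurableSet {p : E × ℝ | ‖p.2 ^ (-(1 / α))‖ * ‖p.1‖ < r} :=
      measurableSet_lt (by fun_prop) measurable_const
    exact measurable_measure_prodMk_left (ν := CV2X.shadowingLaw w δ) hT
  have hsub : ∀ x : E, CV2X.shadowingLaw w δ {c | r ≤ ‖c ^ (-(1 / α))‖ * ‖x‖} = 1 - u x := by
    intro x
    rw [hu, ← prob_compl_eq_one_sub (measurableSet_lt (by fun_prop) measurable_const)]
    congr 1
    ext
    simp
  have hI : ∫⁻ x, u x
      = ENNReal.ofReal (K * r ^ d * ∫ c, c ^ ((d : ℝ) / α) ∂(CV2X.shadowingLaw w δ)) :=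
    CV2X.lintegral_shadowingLaw_lt hK hball hr
  have hnn : 0 ≤ ∫ c, c ^ ((d : ℝ) / α) ∂(CV2X.shadowingLaw w δ) :=
    integral_nonneg_of_ae <| by
      filter_upwards [CV2X.ae_pos_shadowingLaw w δ] with c hc using Real.rpow_nonneg hc.le _
  rw [hset, hanti.measure_iInter (fun k => (hmeas k).nullMeasurableSet)
    ⟨0, measure_ne_top _ _⟩]
  simp_rw [hX.measure_forall_lt_displaced, hsub]
  rw [← lintegral_iInf]
  · rw [hX.points.lintegral_iInf_prod hum (fun x => prob_le_one) (by simp [hI]), hI,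
      ← ENNReal.ofReal_mul hlam, ENNReal.toReal_ofReal (by positivity), CV2X.displacedDensity]
    congr 3
    ring
  · exact fun k => Finset.measurable_fun_prod _ fun i _ =>
      measurable_const.sub (hum.comp (hXm i))
  · exact fun m n hmn ω => ENNReal.antitone_prod_range (fun i => tsub_le_self) hmn
  · simp

end Displacement

/-! ### Laws of the distances and the resulting integrals -/

theorem ProbabilityTheory.expMeasure_Ici {l : ℝ} (hl : 0 < l) {x : ℝ} (hx : 0 ≤ x) :
    expMeasure l (Set.Ici x) = ENNReal.ofReal (Real.exp (-(l * x))) := by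
  have := isProbabilityMeasure_expMeasure hl
  have hac : expMeasure l ≪ volume := withDensity_absolutelyContinuous _ _
  have h1 : expMeasure l (Set.Ici x) = expMeasure l (Set.Ioi x) :=
    (measure_congr (Ioi_ae_eq_Ici' (hac (measure_singleton x)))).symm
  have h2 := cdf_expMeasure_eq hl x
  rw [cdf_eq_real, if_pos hx] at h2
  rw [h1, ← Set.compl_Iic, prob_compl_eq_one_sub measurableSet_Iic, ← ofReal_measureReal, h2,
    ← ENNReal.ofReal_one, ← ENNReal.ofReal_sub _ (by rw [sub_nonneg]; simp; positivity)]
  congr 1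
  ring

theorem ProbabilityTheory.map_eq_expMeasure {Ω : Type*} [MeasurableSpace Ω] {P : Measure Ω}
    [IsProbabilityMeasure P] {f : Ω → ℝ} (hf : Measurable f) {l : ℝ} (hl : 0 < l)
    (h : ∀ r, 0 ≤ r → P {ω | r ≤ f ω} = ENNReal.ofReal (Real.exp (-(l * r)))) :
    P.map f = expMeasure l := by
  have := isProbabilityMeasure_expMeasure hl
  have := Measure.isProbabilityMeasure_map (μ := P) hf.aemeasurable
  have hpos : ∀ x, 0 ≤ x → P.map f (Set.Ici x) = expMeasure l (Set.Ici x) := fun x hx => by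
    rw [Measure.map_apply hf measurableSet_Ici, expMeasure_Ici hl hx]
    exact h x hx
  refine Measure.ext_of_Ici _ _ fun x => ?_
  rcases le_total 0 x with hx | hx
  · exact hpos x hx
  -- Below 0 nothing is assumed about the tail, but `Set.Ici 0` already carries all the mass.
  · have h1 : ∀ (μ : Measure ℝ) [IsProbabilityMeasure μ], μ (Set.Ici 0) = 1 → μ (Set.Ici x) = 1 :=
      fun μ _ h0 => le_antisymm prob_le_one (h0 ▸ measure_mono (Set.Ici_subset_Ici.2 hx))
    have h2 : expMeasure l (Set.Ici 0) = 1 := by simp [expMeasure_Ici hl le_rfl]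
    rw [h1 _ h2, h1 _ ((hpos 0 le_rfl).trans h2)]

/-- The tail tends to 1 as `r` decreases to 0. Distance 0 has to be excluded because `0 ^ (-α)` is 0
by convention for `α ≠ 0`, which would distort the association rules. -/
theorem ProbabilityTheory.ae_pos_of_measure_le_eq_exp {Ω : Type*} [MeasurableSpace Ω]
    {P : Measure Ω} [IsProbabilityMeasure P] {f : Ω → ℝ} (hf : Measurable f) {a : ℝ} {d : ℕ}
    (hd : d ≠ 0)
    (h : ∀ r, 0 ≤ r → P {ω | r ≤ f ω} = ENNReal.ofReal (Real.exp (-(a * r ^ d)))) :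
    ∀ᵐ ω ∂P, 0 < f ω := by
  have hm : MeasurableSet {ω | 0 < f ω} := measurableSet_lt measurable_const hf
  refine (mem_ae_iff_prob_eq_one hm).2 (le_antisymm prob_le_one ?_)
  have hc : Continuous fun r : ℝ => ENNReal.ofReal (Real.exp (-(a * r ^ d))) :=
    ENNReal.continuous_ofReal.comp (by fun_prop)
  have ht : Filter.Tendsto (fun r : ℝ => ENNReal.ofReal (Real.exp (-(a * r ^ d))))
      (nhdsWithin 0 (Set.Ioi 0)) (nhds 1) := by
    have := (hc.tendsto 0).mono_left (nhdsWithin_le_nhds (s := Set.Ioi 0))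
    simpa [zero_pow hd] using this
  refine le_of_tendsto ht ?_
  filter_upwards [self_mem_nhdsWithin] with r hr
  rw [← h r (le_of_lt hr)]
  exact measure_mono fun ω (hω : r ≤ f ω) => lt_of_lt_of_le (Set.mem_Ioi.1 hr) hω

theorem ProbabilityTheory.lintegral_expMeasure {l : ℝ} {g : ℝ → ℝ≥0∞} (hg : Measurable g) :
    ∫⁻ x, g x ∂(expMeasure l)
      = ∫⁻ x in Set.Ioi 0, ENNReal.ofReal (l * Real.exp (-(l * x))) * g x := by
  have h : expMeasure l = volume.withDensity (exponentialPDF l) := rfl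
  have hp : Measurable (exponentialPDF l) := (measurable_exponentialPDFReal l).ennreal_ofReal
  rw [h, lintegral_withDensity_eq_lintegral_mul _ hp hg, restrict_Ioi_eq_restrict_Ici,
    ← lintegral_indicator measurableSet_Ici]
  refine lintegral_congr fun x => ?_
  by_cases hx : 0 ≤ x
  · simp [hx, exponentialPDF_of_nonneg hx]
  · simp [hx, exponentialPDF_of_neg (not_le.1 hx)]

theorem integrableOn_mul_exp_neg_mul_rpow_sub {a l p : ℝ} (ha : 0 ≤ a) (hl : 0 < l) :
    IntegrableOn (fun x : ℝ => l * Real.exp (-(a * x ^ p) - l * x)) (Set.Ioi 0) := by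
  refine Integrable.mono' (g := fun x => l * Real.exp (-l * x))
    ((exp_neg_integrableOn_Ioi 0 hl).const_mul l) ?_ ?_
  · exact Measurable.aestronglyMeasurable (by fun_prop)
  · filter_upwards [ae_restrict_mem measurableSet_Ioi] with x hx
    have hx0 : (0 : ℝ) < x := hx
    rw [Real.norm_of_nonneg (by positivity)]
    gcongr
    have : 0 ≤ a * x ^ p := by positivity
    linarith

/-- The probability that `M` exceeds `b * S ^ q`, for independent `M` and `S` with `S` exponential
and `M` of Rayleigh type. -/
theorem measureReal_mul_rpow_le_of_indepFun {Ω : Type*} [MeasurableSpace Ω] {P : Measure Ω}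
    [IsProbabilityMeasure P] {M S : Ω → ℝ} (hM : Measurable M) (hS : Measurable S)
    (hMS : IndepFun M S P) {a b l q : ℝ} (hl : 0 < l) (ha : 0 ≤ a) (hb : 0 ≤ b)
    (hMtail : ∀ r, 0 ≤ r → P {ω | r ≤ M ω} = ENNReal.ofReal (Real.exp (-(a * r ^ 2))))
    (hStail : ∀ r, 0 ≤ r → P {ω | r ≤ S ω} = ENNReal.ofReal (Real.exp (-(l * r)))) :
    P.real {ω | b * S ω ^ q ≤ M ω}
      = ∫ x in Set.Ioi 0, l * Real.exp (-(a * b ^ 2 * x ^ (2 * q)) - l * x) := by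
  have hT : MeasurableSet {p : ℝ × ℝ | b * p.2 ^ q ≤ p.1} :=
    measurableSet_le (by fun_prop) measurable_fst
  have hmap := (indepFun_iff_map_prod_eq_prod_map_map hM.aemeasurable hS.aemeasurable).1 hMS
  have := Measure.isProbabilityMeasure_map (μ := P) hM.aemeasurable
  have := isProbabilityMeasure_expMeasure hl
  have h1 : P {ω | b * S ω ^ q ≤ M ω}
      = P.map (fun ω => (M ω, S ω)) {p : ℝ × ℝ | b * p.2 ^ q ≤ p.1} :=
    (Measure.map_apply (hM.prodMk hS) hT).symm
  rw [measureReal_def, h1, hmap, map_eq_expMeasure hS hl hStail, Measure.prod_apply_symm hT,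
    lintegral_expMeasure (measurable_measure_prodMk_right hT),
    integral_eq_lintegral_of_nonneg_ae (Filter.Eventually.of_forall fun x => by positivity)
      (integrableOn_mul_exp_neg_mul_rpow_sub (by positivity) hl).aestronglyMeasurable]
  congr 1
  refine setLIntegral_congr_fun measurableSet_Ioi fun x hx => ?_
  have hx0 : (0 : ℝ) < x := hx
  -- Given `S = x`, what remains is the tail of `M` at `b * x ^ q`.
  have h2 : P.map M ((fun m => (m, x)) ⁻¹' {p : ℝ × ℝ | b * p.2 ^ q ≤ p.1})
      = ENNReal.ofReal (Real.exp (-(a * (b * x ^ q) ^ 2))) := by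
    rw [Measure.map_apply hM (measurable_prodMk_right hT), ← hMtail _ (by positivity)]
    rfl
  simp only [h2]
  rw [← ENNReal.ofReal_mul (by positivity), mul_assoc, ← Real.exp_add, mul_pow,
    ← Real.rpow_natCast (x ^ q), ← Real.rpow_mul hx0.le]
  congr 3
  rw [mul_comm q]
  push_cast
  ring

/-- Complete the square, `a x² + 2 l x = (√a x + l/√a)² - l²/a`, then rescale by `√a` and translate
by `l/√a`. -/
theorem integral_mul_exp_neg_mul_sq_sub {a l : ℝ} (ha : 0 < a) :
    ∫ x in Set.Ioi (0 : ℝ), l * Real.exp (-(a * x ^ 2) - 2 * l * x)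
      = l * Real.sqrt Real.pi / (2 * Real.sqrt a) * Real.exp (l ^ 2 / a)
          * CV2X.erfc (l / Real.sqrt a) := by
  have hs : 0 < Real.sqrt a := Real.sqrt_pos.2 ha
  have hsq : Real.sqrt a ^ 2 = a := Real.sq_sqrt ha.le
  have h1 : ∀ x : ℝ, l * Real.exp (-(a * x ^ 2) - 2 * l * x)
      = l * Real.exp (l ^ 2 / a) * Real.exp (-(Real.sqrt a * x + l / Real.sqrt a) ^ 2) := fun x => by
    rw [mul_assoc l, ← Real.exp_add]
    congr 2
    have : (Real.sqrt a * x + l / Real.sqrt a) ^ 2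
        = Real.sqrt a ^ 2 * x ^ 2 + 2 * l * x + l ^ 2 / Real.sqrt a ^ 2 := by
      field_simp
      ring
    rw [this, hsq]
    ring
  have h2 : ∫ y in Set.Ioi (0 : ℝ), Real.exp (-(y + l / Real.sqrt a) ^ 2)
      = ∫ t in Set.Ioi (l / Real.sqrt a), Real.exp (-t ^ 2) := by
    simpa using (measurePreserving_add_right volume (l / Real.sqrt a)).setIntegral_preimage_emb
      (measurableEmbedding_addRight _) (fun t => Real.exp (-t ^ 2)) (Set.Ioi (l / Real.sqrt a))
  have hpi : Real.sqrt Real.pi ≠ 0 := (Real.sqrt_pos.2 Real.pi_pos).ne'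
  simp_rw [h1]
  rw [integral_const_mul, integral_comp_mul_left_Ioi
    (fun y => Real.exp (-(y + l / Real.sqrt a) ^ 2)) 0 hs, mul_zero, h2, CV2X.erfc, smul_eq_mul]
  field_simp

/-! ### Association rules and the probability of Case 1 -/

theorem mul_rpow_neg_lt_mul_rpow_neg_iff {p q m s a b : ℝ} (hq : 0 < q)
    (hm : 0 < m) (hs : 0 < s) :
    q * s ^ (-b) < p * m ^ (-a) ↔ m ^ a < p / q * s ^ b := by
  have h1 := Real.rpow_pos_of_pos hm a
  have h2 := Real.rpow_pos_of_pos hs b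
  rw [Real.rpow_neg hm.le, Real.rpow_neg hs.le, ← div_eq_mul_inv, ← div_eq_mul_inv,
    div_lt_div_iff₀ h2 h1, div_mul_eq_mul_div, lt_div_iff₀ hq, mul_comm q]

/-- When `B < A` the uplink rule implies the downlink rule. -/
theorem CV2X.downlinkMBS_and_uplinkMBS_iff {PM GM PS GS0 PV GV1 GV0 αM αS m s : ℝ}
    (hPS : 0 < PS) (hGS0 : 0 < GS0) (hPV : 0 < PV) (hGV1 : 0 < GV1) (hGV0 : 0 < GV0)
    (hαM : 0 < αM) (hAB : PV * GV1 / (PV * GV0) < PM * GM / (PS * GS0)) (hm : 0 < m) (hs : 0 < s) :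
    CV2X.DownlinkMBS PM GM PS GS0 αM αS m s ∧ CV2X.UplinkMBS PV GV1 GV0 αM αS m s
      ↔ m < (PV * GV1 / (PV * GV0)) ^ (1 / αM) * s ^ (αS / αM) := by
  have hsS := Real.rpow_pos_of_pos hs αS
  rw [CV2X.DownlinkMBS, CV2X.UplinkMBS, gt_iff_lt, gt_iff_lt,
    mul_rpow_neg_lt_mul_rpow_neg_iff (by positivity) hm hs,
    mul_rpow_neg_lt_mul_rpow_neg_iff (by positivity) hm hs]
  -- Writing the uplink bound as an `αM`-th power lets the exponent be removed by monotonicity.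
  have h1 : (PV * GV1 / (PV * GV0)) * s ^ αS
      = ((PV * GV1 / (PV * GV0)) ^ (1 / αM) * s ^ (αS / αM)) ^ αM := by
    rw [Real.mul_rpow (by positivity) (by positivity), ← Real.rpow_mul (by positivity),
      ← Real.rpow_mul hs.le, one_div_mul_cancel hαM.ne', Real.rpow_one, div_mul_cancel₀ _ hαM.ne']
  rw [and_iff_right_of_imp fun h => h.trans (by gcongr), h1,
    Real.rpow_lt_rpow_iff hm.le (by positivity) hαM]

theorem CV2X.displacedDensity_pos (d : ℕ) {lam : ℝ} (hlam : 0 < lam) (α w : ℝ) (δ : ℝ≥0) :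
    0 < CV2X.displacedDensity d lam α w δ := by
  refine mul_pos ((integral_pos_iff_support_of_nonneg_ae ?_
    (CV2X.integrable_rpow_shadowingLaw w δ _)).2 ?_) hlam
  · filter_upwards [CV2X.ae_pos_shadowingLaw w δ] with c hc using Real.rpow_nonneg hc.le _
  · have : ∀ᵐ c ∂(CV2X.shadowingLaw w δ), c ∈ Function.support fun c : ℝ => c ^ ((d : ℝ) / α) := by
      filter_upwards [CV2X.ae_pos_shadowingLaw w δ] with c hc
        using (Real.rpow_pos_of_pos hc _).ne'
    rw [(mem_ae_iff_prob_eq_one (measurableSet_support (by fun_prop))).1 this]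
    exact one_pos

theorem lemma1 {Ω : Type*} [MeasurableSpace Ω] (P : Measure Ω) [IsProbabilityMeasure P]
    (lamm lams PM GM PS GS0 PV GV1 GV0 αM αS wM wS : ℝ) (δM δS : ℝ≥0)
    (hlamm : 0 < lamm) (hlams : 0 < lams)
    (hPM : 0 < PM) (hGM : 0 < GM) (hPS : 0 < PS) (hGS0 : 0 < GS0)
    (hPV : 0 < PV) (hGV1 : 0 < GV1) (hGV0 : 0 < GV0) (hαM : 0 < αM) (hαS : 0 < αS)
    (A B lamM lamS : ℝ)
    (hA : A = PM * GM / (PS * GS0)) (hB : B = PV * GV1 / (PV * GV0)) (hAB : B < A)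
    (hlamM : lamM = CV2X.displacedDensity 2 lamm αM wM δM)
    (hlamS : lamS = CV2X.displacedDensity 1 lams αS wS δS)
    (X : ℕ → Ω → EuclideanSpace ℝ (Fin 2)) (χ : ℕ → Ω → ℝ)
    (S : ℕ → Ω → ℝ) (ψ : ℕ → Ω → ℝ)
    (hX : CV2X.IsShadowedPoissonProcess P lamm wM δM X χ)
    (hS : CV2X.IsShadowedPoissonProcess P lams wS δS S ψ)
    (hXS : IndepFun (fun ω i => (X i ω, χ i ω)) (fun ω i => (S i ω, ψ i ω)) P) :
    IntegrableOn (fun x : ℝ => 2 * lamS *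
        Real.exp (-(lamM * Real.pi * B ^ (2 / αM) * x ^ (2 * αS / αM)) - 2 * lamS * x))
        (Set.Ioi 0) ∧
    P.real (CV2X.caseOne PM GM PS GS0 PV GV1 GV0 αM αS X χ S ψ)
      = 1 - ∫ x in Set.Ioi (0 : ℝ), 2 * lamS *
          Real.exp (-(lamM * Real.pi * B ^ (2 / αM) * x ^ (2 * αS / αM)) - 2 * lamS * x) ∧
    (αS = αM →
      P.real (CV2X.caseOne PM GM PS GS0 PV GV1 GV0 αM αS X χ S ψ)
        = 1 - Real.sqrt (lamS ^ 2 / (lamM * B ^ (2 / αM))) *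
            Real.exp (lamS ^ 2 / (lamM * Real.pi * B ^ (2 / αM))) *
            CV2X.erfc (lamS / Real.sqrt (lamM * Real.pi * B ^ (2 / αM)))) := by
  have hBpos : 0 < B := by rw [hB]; positivity
  have hlamM0 : 0 < lamM := hlamM ▸ CV2X.displacedDensity_pos 2 hlamm αM wM δM
  have hlamS0 : 0 < lamS := hlamS ▸ CV2X.displacedDensity_pos 1 hlams αS wS δS
  set M := CV2X.nearestDist (CV2X.displaced αM X χ) with hMdef
  set N := CV2X.nearestDist (CV2X.displaced αS S ψ) with hNdef
  have hM : Measurable M :=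
    CV2X.measurable_nearestDist_displaced αM hX.points.measurable hX.gain_measurable
  have hN : Measurable N :=
    CV2X.measurable_nearestDist_displaced αS hS.points.measurable hS.gain_measurable
  have hMtail : ∀ r, 0 ≤ r →
      P {ω | r ≤ M ω} = ENNReal.ofReal (Real.exp (-(lamM * Real.pi * r ^ 2))) := fun r hr => by
    rw [hlamM]
    refine hX.measure_le_nearestDist hlamm.le Real.pi_pos.le (fun s hs => ?_) hr
    rw [EuclideanSpace.volume_ball_fin_two, ← ENNReal.ofReal_pow hs,
      ← ENNReal.ofReal_mul (by positivity), mul_comm]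
  have hNtail : ∀ r, 0 ≤ r →
      P {ω | r ≤ N ω} = ENNReal.ofReal (Real.exp (-(2 * lamS * r))) := fun r hr => by
    -- An interval of radius `s` has length `2 * s`: hence `K = 2`, and the factor 2 in `2 * lamS`.
    have h := hS.measure_le_nearestDist (α := αS) (d := 1) hlams.le zero_le_two
      (fun s _ => by rw [Real.volume_ball, pow_one]) hr
    rw [← hlamS, pow_one, mul_comm lamS] at h
    exact h
  have hMN : IndepFun M N P := by
    -- Each distance is a measurable function of its own tier's locations and gains, and the tiers
    -- are independent.
    have h1 : Measurable fun p : ℕ → EuclideanSpace ℝ (Fin 2) × ℝ =>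
        ⨅ i, ‖(p i).2 ^ (-(1 / αM))‖ * ‖(p i).1‖ := Measurable.iInf fun i => by fun_prop
    have h2 : Measurable fun p : ℕ → ℝ × ℝ =>
        ⨅ i, ‖(p i).2 ^ (-(1 / αS))‖ * ‖(p i).1‖ := Measurable.iInf fun i => by fun_prop
    have h3 := hXS.comp h1 h2
    simp only [Function.comp_def, ← norm_smul] at h3
    exact h3
  have hMpos : ∀ᵐ ω ∂P, 0 < M ω := ae_pos_of_measure_le_eq_exp hM two_ne_zero hMtail
  have hNpos : ∀ᵐ ω ∂P, 0 < N ω :=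
    ae_pos_of_measure_le_eq_exp hN one_ne_zero (by simpa only [pow_one] using hNtail)
  have hcase : CV2X.caseOne PM GM PS GS0 PV GV1 GV0 αM αS X χ S ψ
      =ᵐ[P] ({ω | B ^ (1 / αM) * N ω ^ (αS / αM) ≤ M ω}ᶜ : Set Ω) := by
    refine Filter.eventuallyEq_set.2 ?_
    filter_upwards [hMpos, hNpos] with ω hm hn
    rw [Set.mem_compl_iff, Set.mem_ofPred_eq, not_le, hB]
    exact CV2X.downlinkMBS_and_uplinkMBS_iff hPS hGS0 hPV hGV1 hGV0 hαM (hA ▸ hB ▸ hAB) hm hn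
  have hBsq : (B ^ (1 / αM)) ^ 2 = B ^ (2 / αM) := by
    rw [← Real.rpow_natCast, ← Real.rpow_mul hBpos.le]
    congr 1
    push_cast
    ring
  have hprob : P.real (CV2X.caseOne PM GM PS GS0 PV GV1 GV0 αM αS X χ S ψ)
      = 1 - ∫ x in Set.Ioi (0 : ℝ), 2 * lamS *
          Real.exp (-(lamM * Real.pi * B ^ (2 / αM) * x ^ (2 * αS / αM)) - 2 * lamS * x) := by
    rw [measureReal_congr hcase, probReal_compl_eq_one_sub
      (measurableSet_le ((hN.pow_const _).const_mul _) hM),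
      measureReal_mul_rpow_le_of_indepFun hM hN hMN (by positivity) (by positivity)
        (by positivity) hMtail hNtail, hBsq, mul_div_assoc]
  refine ⟨integrableOn_mul_exp_neg_mul_rpow_sub (by positivity) (by positivity), hprob,
    fun hα => ?_⟩
  have hB2 : 0 < B ^ (2 / αM) := Real.rpow_pos_of_pos hBpos _
  have hsqrt : Real.sqrt (lamM * Real.pi * B ^ (2 / αM))
      = Real.sqrt (lamM * B ^ (2 / αM)) * Real.sqrt Real.pi := by
    rw [← Real.sqrt_mul (by positivity), mul_right_comm]
  have hpi : Real.sqrt Real.pi ≠ 0 := (Real.sqrt_pos.2 Real.pi_pos).ne'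
  have hMB : Real.sqrt (lamM * B ^ (2 / αM)) ≠ 0 := (Real.sqrt_pos.2 (by positivity)).ne'
  rw [hprob, hα, mul_div_cancel_right₀ _ hαM.ne']
  -- The leading 2 is split off so that the Gaussian integral applies with `l = lamS`, not `2 *
  -- lamS`.
  simp_rw [Real.rpow_two, mul_assoc 2 lamS (Real.exp _)]
  rw [integral_const_mul, integral_mul_exp_neg_mul_sq_sub (by positivity),
    Real.sqrt_div (by positivity), Real.sqrt_sq hlamS0.le]
  have hcoef : 2 * (lamS * Real.sqrt Real.pi / (2 * Real.sqrt (lamM * Real.pi * B ^ (2 / αM))))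
      = lamS / Real.sqrt (lamM * B ^ (2 / αM)) := by
    rw [hsqrt]
    field_simp
  rw [← mul_assoc, ← mul_assoc, hcoef]
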